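/- Let $R$ be a commutative Noetherian ring, let $\mathcal S$ be a Serre class of $R$-modules (it contains $0$, and for every short exact sequence $0\to L\to N\to K\to 0$ one has $N\in\mathcal S$ if and only if $L,K\in\mathcal S$), and let $M$ be a finitely generated $R$-module. All infima below are taken in $\mathbb N_0\cup\{\infty\}$, with $\inf\emptyset=\infty$. For an $R$-module $L$ put $\mathcal S\text{-}\operatorname{Supp}(L)=\{\mathfrak p\in\operatorname{Supp}L : R/\mathfrak p\notin\mathcal S\}$ and $\mathcal S\text{-}\operatorname{Ass}(L)=\{\mathfrak p\in\operatorname{Ass}L : R/\mathfrak p\notin\mathcal S\}$. For a prime $\mathfrak q\in\operatorname{Supp}M$ let $\operatorname{ht}_M(\mathfrak q)=\dim M_{\mathfrak q}$, which is the supremum of the lengths of chains of primes in $\operatorname{Supp}M$ ending at $\mathfrak q$. For an ideal $\mathfrak a$ put $$\operatorname{ht}_M(\mathfrak a)=\inf\{\operatorname{ht}_M(\mathfrak q):\mathfrak q\in\operatorname{Supp}M,\ \mathfrak a\subseteq\mathfrak q\},$$ $$\mathcal S\text{-}\operatorname{ht}_M(\mathfrak a)=\inf\{\operatorname{ht}_M(\mathfrak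 q):\mathfrak q\in\mathcal S\text{-}\operatorname{Supp}(M),\ \mathfrak a\subseteq\mathfrak q\},$$ $$\mathcal S\text{-}E.\operatorname{grade}(\mathfrak a,M)=\inf\{i\in\mathbb N_0:\operatorname{Ext}^i_R(R/\mathfrak a,M)\notin\mathcal S\}.$$ An ideal $\mathfrak a$ is called unmixed on $M$ with respect to $\mathcal S$ if $\mathcal S\text{-}\operatorname{Ass}(M/\mathfrak aM)$ is the set of those minimal elements $\mathfrak p$ of $\operatorname{Supp}(M/\mathfrak aM)$ with $R/\mathfrak p\notin\mathcal S$. **Proposition 3.3.** The following are equivalent: 1. $\mathcal S\text{-}E.\operatorname{grade}(\mathfrak a,M)=\mathcal S\text{-}\operatorname{ht}_M(\mathfrak a)$ for every ideal $\mathfrak a$ of $R$; 2. $\mathcal S\text{-}E.\operatorname{grade}(\mathfrak p,M)=\mathcal S\text{-}\operatorname{ht}_M(\mathfrak p)=\operatorname{ht}_M(\mathfrak p)$ for every $\mathfrak p\in\mathcal S\text{-}\operatorname{Supp}(M)$; 3. for every $\mathfrak p\in\mathcal S\text{-}\operatorname{Supp}(M)$, the $R_{\mathfrak p}$-module $M_{\mathfrak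 p}$ is Cohen–Macaulay; 4. every ideal $\mathfrak a$ with $\operatorname{ht}_M(\mathfrak a)<\infty$ that can be generated by $\operatorname{ht}_M(\mathfrak a)$ elements is unmixed on $M$ with respect to $\mathcal S$. -/

import Mathlib

open CategoryTheory

universe u

namespace SerreCM

section Local

/-- The depth of a module over a local ring: the supremum of the lengths of the regular
sequences on `M` contained in the maximal ideal. -/
noncomputable def depth (A : Type*) [CommRing A] [IsLocalRing A]
    (M : Type*) [AddCommGroup M] [Module A M] : ℕ∞ :=
  ⨆ (rs : List A) (_ : (∀ x ∈ rs, x ∈ IsLocalRing.maximalIdeal A) ∧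
    RingTheory.Sequence.IsRegular M rs), (rs.length : ℕ∞)

/-- Cohen–Macaulay modules over a local ring (used for finitely generated modules over Noetherian
local rings): either `M = 0` or `depth M = dim M`. -/
def IsCohenMacaulay (A : Type*) [CommRing A] [IsLocalRing A]
    (M : Type*) [AddCommGroup M] [Module A M] : Prop :=
  Subsingleton M ∨ (depth A M : WithBot ℕ∞) = Module.supportDim A M

end Local

section Height

variable (R : Type*) [CommRing R] (M : Type*) [AddCommGroup M] [Module R M]

/-- The height `ht_M(𝔞)`: the infimum, over the primes `𝔮 ∈ Supp M` containing `𝔞`, of the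
supremum of the lengths of chains of primes in `Supp M` ending at `𝔮` (that is, of `dim M_𝔮`).
It is `⊤` if there is no such prime. -/
noncomputable def ht (a : Ideal R) : ℕ∞ :=
  ⨅ (q : Module.support R M) (_ : a ≤ q.1.asIdeal), Order.height q

end Height

variable {R : Type u} [CommRing R] (S : ObjectProperty (ModuleCat.{u} R))

/-- `S-Supp M`: the primes `𝔭 ∈ Supp M` with `R/𝔭 ∉ S`. -/
def sSupp (M : Type u) [AddCommGroup M] [Module R M] : Set (PrimeSpectrum R) :=
  {p | p ∈ Module.support R M ∧ ¬ S (ModuleCat.of R (R ⧸ p.asIdeal))}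

/-- `S-Ass M`: the primes `𝔭 ∈ Ass M` with `R/𝔭 ∉ S`. -/
def sAss (M : Type u) [AddCommGroup M] [Module R M] : Set (PrimeSpectrum R) :=
  {p | p.asIdeal ∈ associatedPrimes R M ∧ ¬ S (ModuleCat.of R (R ⧸ p.asIdeal))}

/-- `S-E.grade(𝔞, M)`: the infimum in `ℕ ∪ {∞}` of the `i` with `Ext^i(R/𝔞, M) ∉ S`. -/
noncomputable def sEGrade (a : Ideal R) (M : Type u) [AddCommGroup M] [Module R M] : ℕ∞ :=
  ⨅ (i : ℕ) (_ : ¬ S (ModuleCat.of R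
    (Abelian.Ext (ModuleCat.of R (R ⧸ a)) (ModuleCat.of R M) i))), (i : ℕ∞)

/-- `S-ht_M(𝔞)`: the infimum of `ht_M(𝔮)` over `𝔮 ∈ S-Supp M ∩ V(𝔞)`. -/
noncomputable def sHt (M : Type u) [AddCommGroup M] [Module R M] (a : Ideal R) : ℕ∞ :=
  ⨅ (q : PrimeSpectrum R) (_ : q ∈ sSupp S M ∩ PrimeSpectrum.zeroLocus (a : Set R)),
    ht R M q.asIdeal

/-- `𝔞` is unmixed on `M` with respect to `S`: `S-Ass (M/𝔞M)` is the set of minimal members `𝔭`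
of `Supp (M/𝔞M)` with `R/𝔭 ∉ S`. -/
def IsUnmixedOn (a : Ideal R) (M : Type u) [AddCommGroup M] [Module R M] : Prop :=
  sAss S (M ⧸ (a • ⊤ : Submodule R M)) =
    {p | Minimal (· ∈ Module.support R (M ⧸ (a • ⊤ : Submodule R M))) p ∧
      ¬ S (ModuleCat.of R (R ⧸ p.asIdeal))}

end SerreCM

/-! The heart is a grade formula, `natCast_le_sEGrade_iff`: the `S`-grade of `𝔞` on `M` is the
infimum of `depth M_𝔮` over the `𝔮 ∈ S-Supp M` containing `𝔞`. For the induction, take `x ∈ 𝔞`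
outside every prime of `S-Ass M`. Then `0 :_M x` lies in `S`, so modulo `S` the element `x` behaves
as if regular and passing to `M/xM` lowers the grade by one. If `R/𝔮 ∉ S`, no prime below `𝔮` has
its quotient in `S`, so `x` is regular on `M_𝔮` and the depth there also drops by one. Since `depth
M_𝔮 ≤ ht_M(𝔮)`, with equality exactly when `M_𝔮` is Cohen–Macaulay, the formula makes (1), (2) and
(3) equivalent.

For (3) ⇒ (4), `depthAt_le_length` bounds the depth at an associated prime of `M/𝔞M` by the number
`n` of generators. Under (3) this bounds its height, while every prime of `Supp M` over `𝔞` has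
height at least `n`; hence it is minimal.

For (4) ⇒ (3), `exists_list_of_isUnmixedOn` chooses elements of `𝔭` one at a time, outside the
minimal primes of the current quotient. Krull's theorem keeps the height equal to the number of
elements, and unmixedness makes each new element regular at `𝔭`, so `depth M_𝔭` reaches `ht_M(𝔭)`.
-/

namespace SerreCM

/-! ### Closure properties of Serre classes -/

section SerreClass

variable {R : Type u} [CommRing R] (S : ObjectProperty (ModuleCat.{u} R)) [S.IsSerreClass]
  {L N K : Type u} [AddCommGroup L] [Module R L] [AddCommGroup N] [Module R N]
  [AddCommGroup K] [Module R K]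

lemma prop_of_injective (f : L →ₗ[R] N) (hf : Function.Injective f)
    (hN : S (ModuleCat.of R N)) : S (ModuleCat.of R L) :=
  have : Mono (ModuleCat.ofHom f) := (ModuleCat.mono_iff_injective _).mpr hf
  S.prop_of_mono (ModuleCat.ofHom f) hN

lemma prop_of_surjective (f : L →ₗ[R] N) (hf : Function.Surjective f)
    (hL : S (ModuleCat.of R L)) : S (ModuleCat.of R N) :=
  have : Epi (ModuleCat.ofHom f) := (ModuleCat.epi_iff_surjective _).mpr hf
  S.prop_of_epi (ModuleCat.ofHom f) hL

lemma prop_of_exact (f : L →ₗ[R] N) (g : N →ₗ[R] K) (h : Function.Exact f g)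
    (hL : S (ModuleCat.of R L)) (hK : S (ModuleCat.of R K)) : S (ModuleCat.of R N) := by
  let T : ShortComplex (ModuleCat.{u} R) :=
    ShortComplex.mk (ModuleCat.ofHom f) (ModuleCat.ofHom g)
      (by ext x; exact h.apply_apply_eq_zero x)
  have hT : T.Exact := (ShortComplex.ShortExact.moduleCat_exact_iff_function_exact T).mpr h
  exact S.prop_X₂_of_exact hT hL hK

lemma prop_of_subsingleton [Subsingleton N] : S (ModuleCat.of R N) :=
  S.prop_of_isZero (ModuleCat.isZero_of_subsingleton _)

lemma prop_pi_fin (hK : S (ModuleCat.of R K)) (n : ℕ) : S (ModuleCat.of R (Fin n → K)) := by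
  induction n with
  | zero => exact prop_of_subsingleton S
  | succ n ih =>
    let f : K →ₗ[R] (Fin (n + 1) → K) := LinearMap.single R (fun _ ↦ K) 0
    let g : (Fin (n + 1) → K) →ₗ[R] (Fin n → K) := LinearMap.funLeft R K Fin.succ
    refine prop_of_exact S f g (fun v ↦ ⟨fun h ↦ ⟨v 0, ?_⟩, ?_⟩) hK ih
    · ext i
      refine Fin.cases ?_ (fun j ↦ ?_) i
      · simp [f]
      · simpa [f, g, LinearMap.funLeft] using (congrFun h j).symm
    · rintro ⟨k, rfl⟩
      ext j
      simp [f, g, LinearMap.funLeft]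

/-- A prime filtration of `N` has factors `R/𝔭` with `𝔭 ∈ Supp N`, and `S` is closed under
extensions. -/
lemma prop_of_forall_mem_support [IsNoetherianRing R] [Module.Finite R N]
    (h : ∀ p ∈ Module.support R N, S (ModuleCat.of R (R ⧸ p.asIdeal))) :
    S (ModuleCat.of R N) := by
  induction ‹Module.Finite R N› using
    IsNoetherianRing.induction_on_isQuotientEquivQuotientPrime R with
  | subsingleton N => exact prop_of_subsingleton S
  | quotient N p f =>
    refine prop_of_injective S f.toLinearMap f.injective (h p ?_)
    rw [f.support_eq, Module.mem_support_iff_of_finite, Ideal.annihilator_quotient]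
  | exact N₁ N₂ N₃ f g hf hg hfg h₁ h₃ =>
    refine prop_of_exact S f g hfg (h₁ fun p hp ↦ h p ?_) (h₃ fun p hp ↦ h p ?_)
    · exact Module.support_subset_of_injective f hf hp
    · exact Module.support_subset_of_surjective g hg hp

lemma prop_quotient_of_le {a b : Ideal R} (hab : a ≤ b) (ha : S (ModuleCat.of R (R ⧸ a))) :
    S (ModuleCat.of R (R ⧸ b)) :=
  prop_of_surjective S (Submodule.factor hab) (Submodule.factor_surjective hab) ha

lemma exists_mem_associatedPrimes_le [IsNoetherianRing R] [Module.Finite R N]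
    {p : PrimeSpectrum R} (hp : p ∈ Module.support R N) :
    ∃ q ∈ associatedPrimes R N, q ≤ p.asIdeal := by
  obtain ⟨q, hq, hqp⟩ := Ideal.exists_minimalPrimes_le (Module.mem_support_iff_of_finite.mp hp)
  exact ⟨q, Module.associatedPrimes.minimalPrimes_annihilator_subset_associatedPrimes R N hq, hqp⟩

lemma prop_of_forall_mem_associatedPrimes [IsNoetherianRing R] [Module.Finite R N]
    (h : ∀ p ∈ associatedPrimes R N, S (ModuleCat.of R (R ⧸ p))) :
    S (ModuleCat.of R N) := by
  refine prop_of_forall_mem_support S fun p hp ↦ ?_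
  obtain ⟨q, hq, hqp⟩ := exists_mem_associatedPrimes_le hp
  exact prop_quotient_of_le S hqp (h q hq)

open Abelian

/-- `Ext⁰` is the module of homomorphisms. -/
noncomputable def extZeroEquiv (N K : Type u) [AddCommGroup N] [Module R N]
    [AddCommGroup K] [Module R K] :
    Ext (ModuleCat.of R N) (ModuleCat.of R K) 0 ≃ₗ[R] (N →ₗ[R] K) :=
  Ext.linearEquiv₀.trans (ModuleCat.homLinearEquiv (S := R))

/-- Dimension shifting along a finite free cover of `N`, whose kernel is again finite; in degree
zero, `Hom(N, K)` embeds in a finite power of `K`. -/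
lemma prop_ext [IsNoetherianRing R] [Module.Finite R N] (hK : S (ModuleCat.of R K)) (i : ℕ) :
    S (ModuleCat.of R (Ext (ModuleCat.of R N) (ModuleCat.of R K) i)) := by
  induction i generalizing N with
  | zero =>
    refine prop_of_injective S (extZeroEquiv N K).toLinearMap (extZeroEquiv N K).injective ?_
    obtain ⟨n, f, hf⟩ := Module.Finite.exists_fin' R N
    let g : (N →ₗ[R] K) →ₗ[R] (Fin n → K) :=
      LinearMap.pi fun j ↦ LinearMap.applyₗ (f (Pi.single j 1))
    refine prop_of_injective S g (fun u v huv ↦ ?_) (prop_pi_fin S hK n)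
    refine (LinearMap.cancel_right hf).mp (LinearMap.pi_ext' fun j ↦ LinearMap.ext_ring ?_)
    simpa [g] using congrFun huv j
  | succ i ih =>
    obtain ⟨n, f, hf⟩ := Module.Finite.exists_fin' R N
    let T : ShortComplex (ModuleCat.{u} R) :=
      ShortComplex.mk (ModuleCat.ofHom (LinearMap.ker f).subtype) (ModuleCat.ofHom f)
        (by ext x; exact x.2)
    have hT : T.ShortExact := by
      refine ShortComplex.ShortExact.mk' ?_ ?_ ?_
      · exact (ShortComplex.ShortExact.moduleCat_exact_iff_function_exact T).mpr
          (LinearMap.exact_subtype_ker_map f)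
      · exact (ModuleCat.mono_iff_injective _).mpr (Submodule.injective_subtype _)
      · exact (ModuleCat.epi_iff_surjective _).mpr hf
    have : Projective T.X₂ := ModuleCat.projective_of_free (Pi.basisFun R (Fin n))
    refine prop_of_surjective S
      (Ext.precompOfLinear hT.extClass R (ModuleCat.of R K) (add_comm 1 i)) ?_
      (ih (N := LinearMap.ker f))
    intro e
    obtain ⟨y, hy⟩ := Ext.contravariant_sequence_exact₃ hT (ModuleCat.of R K) e
      (Ext.eq_zero_of_projective _) (add_comm 1 i)
    exact ⟨y, hy⟩

end SerreClass

/-! ### The covariant long exact sequence of `Ext`, as exactness of linear maps -/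

section ExtSequences

open Abelian

variable {R : Type u} [CommRing R] (S : ObjectProperty (ModuleCat.{u} R)) [S.IsSerreClass]
  {T : ShortComplex (ModuleCat.{u} R)} (hT : T.ShortExact) (X : ModuleCat.{u} R)

include hT

lemma exact_postcomp_X₂ (i : ℕ) :
    Function.Exact (Ext.postcompOfLinear (Ext.mk₀ T.f) R X (add_zero i))
      (Ext.postcompOfLinear (Ext.mk₀ T.g) R X (add_zero i)) := by
  intro e
  refine ⟨fun h ↦ Ext.covariant_sequence_exact₂ X hT e h, ?_⟩
  rintro ⟨e, rfl⟩
  simp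

lemma exact_postcomp_X₃ (i : ℕ) :
    Function.Exact (Ext.postcompOfLinear (Ext.mk₀ T.g) R X (add_zero i))
      (Ext.postcompOfLinear hT.extClass R X (rfl : i + 1 = i + 1)) := by
  intro e
  refine ⟨fun h ↦ Ext.covariant_sequence_exact₃ X hT e rfl h, ?_⟩
  rintro ⟨e, rfl⟩
  simp

lemma exact_postcomp_X₁ (i : ℕ) :
    Function.Exact (Ext.postcompOfLinear hT.extClass R X (rfl : i + 1 = i + 1))
      (Ext.postcompOfLinear (Ext.mk₀ T.f) R X (add_zero (i + 1))) := by
  intro e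
  refine ⟨fun h ↦ Ext.covariant_sequence_exact₁ X hT e h rfl, ?_⟩
  rintro ⟨e, rfl⟩
  simp

end ExtSequences

/-! ### The grade relative to `S` and quotients by one element -/

section SGrade

open Abelian Pointwise

variable {R : Type u} [CommRing R] (S : ObjectProperty (ModuleCat.{u} R))

lemma le_sEGrade_iff (a : Ideal R) (M : Type u) [AddCommGroup M] [Module R M] (n : ℕ) :
    (n : ℕ∞) ≤ sEGrade S a M ↔
      ∀ i < n, S (ModuleCat.of R (Ext (ModuleCat.of R (R ⧸ a)) (ModuleCat.of R M) i)) := by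
  simp only [sEGrade, le_iInf_iff, Nat.cast_le]
  exact forall_congr' fun i ↦ by rw [← not_le, not_imp_comm]

variable [S.IsSerreClass]
  {M : Type u} [AddCommGroup M] [Module R M]

lemma shortExact_of_linearMap {L N K : Type u} [AddCommGroup L] [Module R L] [AddCommGroup N]
    [Module R N] [AddCommGroup K] [Module R K] (f : L →ₗ[R] N) (g : N →ₗ[R] K)
    (hf : Function.Injective f) (hg : Function.Surjective g) (h : Function.Exact f g) :
    (ShortComplex.mk (ModuleCat.ofHom f) (ModuleCat.ofHom g)
      (by ext x; exact h.apply_apply_eq_zero x)).ShortExact :=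
  ShortComplex.ShortExact.mk'
    ((ShortComplex.ShortExact.moduleCat_exact_iff_function_exact _).mpr h)
    ((ModuleCat.mono_iff_injective _).mpr hf) ((ModuleCat.epi_iff_surjective _).mpr hg)

/-- Multiplication by an element of `𝔞` annihilates `Ext(R/𝔞, M)`. -/
lemma comp_mk₀_lsmul_eq_zero {a : Ideal R} {x : R} (hx : x ∈ a) (i : ℕ)
    (e : Ext (ModuleCat.of R (R ⧸ a)) (ModuleCat.of R M) i) :
    e.comp (Ext.mk₀ (ModuleCat.ofHom (LinearMap.lsmul R M x))) (add_zero i) = 0 := by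
  have h₁ : ModuleCat.ofHom (LinearMap.lsmul R M x) = x • 𝟙 (ModuleCat.of R M) := by
    ext; simp
  have h₂ : x • 𝟙 (ModuleCat.of R (R ⧸ a)) = 0 := by
    ext
    change x • (Ideal.Quotient.mk a 1) = 0
    rw [Algebra.smul_def, Ideal.Quotient.algebraMap_eq, ← map_mul, mul_one]
    exact Ideal.Quotient.eq_zero_iff_mem.mpr hx
  rw [h₁, Ext.mk₀_smul, Ext.comp_smul, Ext.comp_mk₀_id]
  calc x • e = x • ((Ext.mk₀ (𝟙 _)).comp e (zero_add i)) := by rw [Ext.mk₀_id_comp]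
    _ = 0 := by rw [← Ext.smul_comp, ← Ext.mk₀_smul, h₂, Ext.mk₀_zero, Ext.zero_comp]

/-- Multiplication by `x` factors as `M → xM → M` and is zero on `Ext(R/𝔞, M)`. Forwards,
`Ext^i(M/xM)` sits between `Ext^i(M)` and `Ext^{i+1}(xM)`, and the latter between `Ext^{i+1}(M)` and
`Ext^{i+2}` of the kernel of `x`. Backwards, the image of `Ext^i(M)` in `Ext^i(xM)` dies in
`Ext^i(M)`, so it comes from `Ext^{i-1}(M/xM)`; what `Ext^i(M)` loses on the way comes from the
kernel of `x`. -/
lemma prop_ext_quotSMulTop_iff [IsNoetherianRing R] {a : Ideal R} {x : R} (hx : x ∈ a)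
    (hK : S (ModuleCat.of R (LinearMap.ker (LinearMap.lsmul R M x)))) (n : ℕ) :
    (∀ i < n + 1, S (ModuleCat.of R (Ext (ModuleCat.of R (R ⧸ a)) (ModuleCat.of R M) i))) ↔
      ∀ i < n, S (ModuleCat.of R
        (Ext (ModuleCat.of R (R ⧸ a)) (ModuleCat.of R (QuotSMulTop x M)) i)) := by
  set X := ModuleCat.of R (R ⧸ a)
  let l : M →ₗ[R] M := LinearMap.lsmul R M x
  let Y := LinearMap.range l
  have hY : Y = x • (⊤ : Submodule R M) := by
    ext m
    simp [Y, l, Submodule.mem_smul_pointwise_iff_exists]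
  have h₁ := shortExact_of_linearMap (LinearMap.ker l).subtype l.rangeRestrict
    (Submodule.injective_subtype _) l.surjective_rangeRestrict (by
      rw [LinearMap.exact_iff, LinearMap.ker_rangeRestrict, Submodule.range_subtype])
  have h₂ := shortExact_of_linearMap Y.subtype (x • (⊤ : Submodule R M)).mkQ
    (Submodule.injective_subtype _) (Submodule.mkQ_surjective _) (by
      rw [LinearMap.exact_iff, Submodule.ker_mkQ, Submodule.range_subtype, hY])
  have hcomp (i : ℕ) (e : Ext X (ModuleCat.of R M) i) :
      (e.comp (Ext.mk₀ (ModuleCat.ofHom l.rangeRestrict)) (add_zero i)).comp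
        (Ext.mk₀ (ModuleCat.ofHom Y.subtype)) (add_zero i) = 0 := by
    rw [Ext.comp_assoc_of_second_deg_zero, Ext.mk₀_comp_mk₀]
    exact comp_mk₀_lsmul_eq_zero hx i e
  have hKext (i : ℕ) := prop_ext S (N := R ⧸ a) hK i
  constructor
  · intro h i hi
    refine prop_of_exact S _ _ (exact_postcomp_X₃ h₂ X i) (h i (by omega)) ?_
    exact prop_of_exact S _ _ (exact_postcomp_X₃ h₁ X (i + 1)) (h (i + 1) (by omega)) (hKext _)
  · intro h i hi
    obtain _ | i := i
    -- In degree zero there is no connecting map: `Hom(R/𝔞, xM) → Hom(R/𝔞, M)` is injective, so the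
    -- image is already zero.
    · have : Mono (ModuleCat.ofHom Y.subtype) := h₂.mono_f
      refine prop_of_surjective S (Ext.postcompOfLinear (Ext.mk₀ (ModuleCat.ofHom
        (LinearMap.ker l).subtype)) R X (add_zero 0)) (fun e ↦ ?_) (hKext 0)
      refine ((exact_postcomp_X₂ h₁ X 0) e).mp
        (Ext.postcomp_mk₀_injective_of_mono X (ModuleCat.ofHom Y.subtype) ?_)
      exact (hcomp 0 e).trans (Ext.zero_comp _ _ _ _ (add_zero 0)).symm
    · have hrange : S (ModuleCat.of R (LinearMap.range
          (Ext.postcompOfLinear (Ext.mk₀ (ModuleCat.ofHom l.rangeRestrict)) R X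
            (add_zero (i + 1))))) := by
        refine prop_of_injective S (Submodule.inclusion (p' := LinearMap.range
          (Ext.postcompOfLinear h₂.extClass R X (rfl : i + 1 = i + 1))) ?_)
          (Submodule.inclusion_injective _) ?_
        · rintro _ ⟨e, rfl⟩
          exact ((exact_postcomp_X₁ h₂ X i) _).mp (hcomp _ e)
        · exact prop_of_surjective S _ (LinearMap.surjective_rangeRestrict _) (h i (by omega))
      refine prop_of_exact S (Ext.postcompOfLinear (Ext.mk₀ (ModuleCat.ofHom
        (LinearMap.ker l).subtype)) R X (add_zero (i + 1))) (LinearMap.rangeRestrict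
          (Ext.postcompOfLinear (Ext.mk₀ (ModuleCat.ofHom l.rangeRestrict)) R X
            (add_zero (i + 1)))) ?_ (hKext _) hrange
      rw [LinearMap.exact_iff, LinearMap.ker_rangeRestrict]
      exact (exact_postcomp_X₂ h₁ X (i + 1)).linearMap_ker_eq

/-- An element outside every `𝔭 ∈ S-Ass M` has its annihilator in `M` lying in `S`. -/
lemma prop_ker_lsmul [IsNoetherianRing R] [Module.Finite R M] {x : R}
    (hx : ∀ p ∈ sAss S M, x ∉ p.asIdeal) :
    S (ModuleCat.of R (LinearMap.ker (LinearMap.lsmul R M x))) := by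
  refine prop_of_forall_mem_associatedPrimes S fun p hp ↦ ?_
  have hpM : p ∈ associatedPrimes R M :=
    associatedPrimes.subset_of_injective (Submodule.injective_subtype _) hp
  by_contra hS
  refine hx ⟨p, hp.isPrime⟩ ⟨hpM, hS⟩ (IsAssociatedPrime.annihilator_le hp ?_)
  rw [Submodule.mem_annihilator]
  rintro ⟨m, hm⟩ -
  exact Subtype.ext hm

omit [S.IsSerreClass] in
lemma exists_mem_notMem_sAss [IsNoetherianRing R] [Module.Finite R M] {a : Ideal R}
    (h : ∀ p ∈ sAss S M, ¬ a ≤ p.asIdeal) : ∃ x ∈ a, ∀ p ∈ sAss S M, x ∉ p.asIdeal := by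
  by_contra! hcon
  have hfin : {p ∈ associatedPrimes R M | ¬ S (ModuleCat.of R (R ⧸ p))}.Finite :=
    (associatedPrimes.finite R M).subset (Set.sep_subset _ _)
  obtain ⟨p, ⟨hp, hpS⟩, hap⟩ :=
    (a.subset_union_prime_finite hfin (f := id) 0 0 fun _ h _ _ ↦ h.1.isPrime).1 fun x hx ↦ by
      obtain ⟨p, hp, hxp⟩ := hcon x hx
      exact Set.mem_biUnion (x := p.asIdeal) ⟨hp.1, hp.2⟩ hxp
  exact h ⟨p, hp.isPrime⟩ ⟨hp, hpS⟩ hap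

/-- If `𝔞 ⊆ 𝔭 = ann m`, the map `R/𝔞 → M` sending `1` to `m` has annihilator `𝔭`. Thus `R/𝔭` embeds
in `Hom(R/𝔞, M)`, which would force `R/𝔭 ∈ S`. -/
lemma not_le_of_mem_sAss [IsNoetherianRing R] {a : Ideal R}
    (h : S (ModuleCat.of R (Ext (ModuleCat.of R (R ⧸ a)) (ModuleCat.of R M) 0)))
    {p : PrimeSpectrum R} (hpM : p ∈ sAss S M) : ¬ a ≤ p.asIdeal := by
  intro hap
  obtain ⟨hp, hpS⟩ := hpM
  obtain ⟨hpp, m, hpm⟩ := (isAssociatedPrime_iff).mp hp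
  rw [hpm] at hap hpS
  have hmem (r : R) : r ∈ (⊥ : Submodule R M).colon {m} ↔ r • m = 0 := by
    rw [Submodule.mem_colon_singleton, Submodule.mem_bot]
  let φ : R ⧸ a →ₗ[R] M := Submodule.liftQ a (LinearMap.toSpanSingleton R M m)
    fun r hr ↦ (hmem r).mp (hap hr)
  have hφ₁ : φ 1 = m := by
    change LinearMap.toSpanSingleton R M m 1 = m
    simp
  have hφ (r : R) : r • φ = 0 ↔ r • m = 0 := by
    refine ⟨fun h ↦ ?_, fun h ↦ ?_⟩
    · simpa [hφ₁] using congrArg (· 1) h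
    · ext
      change r • φ 1 = 0
      rwa [hφ₁]
  refine hpS (prop_of_injective S (Submodule.liftQ _
    (LinearMap.toSpanSingleton R (R ⧸ a →ₗ[R] M) φ)
    fun r hr ↦ (hφ r).mpr ((hmem r).mp hr)) ?_
      (prop_of_surjective S (extZeroEquiv (R ⧸ a) M).toLinearMap
        (extZeroEquiv (R ⧸ a) M).surjective h))
  rw [← LinearMap.ker_eq_bot]
  exact Submodule.ker_liftQ_eq_bot _ _ _ fun r hr ↦ (hmem r).mpr ((hφ r).mp hr)

end SGrade

/-! ### Depth over a local ring by regular sequences -/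

section LocalDepth

open Abelian Pointwise IsLocalRing RingTheory.Sequence

variable {A : Type*} [CommRing A] [IsLocalRing A] {N N' : Type*} [AddCommGroup N] [Module A N]
  [AddCommGroup N'] [Module A N']

lemma depth_congr (e : N ≃ₗ[A] N') : depth A N = depth A N' := by
  simp only [depth, e.isRegular_congr]

lemma natCast_le_depth_iff [Module.Finite A N] [Nontrivial N] (n : ℕ) :
    (n : ℕ∞) ≤ depth A N ↔
      ∃ rs : List A, rs.length = n ∧ (∀ x ∈ rs, x ∈ maximalIdeal A) ∧ IsRegular N rs := by
  constructor
  · intro h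
    obtain _ | n := n
    · exact ⟨[], rfl, by simp, .nil A N⟩
    -- A supremum need not be attained, but exceeding `n` strictly gives a regular sequence of
    -- length at least `n + 1`, which is then truncated.
    · have h' : (n : ℕ∞) < depth A N := by
        refine lt_of_lt_of_le ?_ h
        exact_mod_cast n.lt_succ_self
      simp only [depth, lt_iSup_iff, Nat.cast_lt] at h'
      obtain ⟨rs, ⟨hrs, hreg⟩, hn⟩ := h'
      have hmem : ∀ x ∈ rs.take (n + 1), x ∈ maximalIdeal A :=
        fun x hx ↦ hrs x (List.mem_of_mem_take hx)
      refine ⟨rs.take (n + 1), by simpa using hn, hmem, ?_⟩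
      refine .of_isWeaklyRegular_of_mem_maximalIdeal N hmem ?_
      have := hreg.toIsWeaklyRegular
      rw [← List.take_append_drop (n + 1) rs, isWeaklyRegular_append_iff] at this
      exact this.1
  · rintro ⟨rs, rfl, hrs⟩
    exact le_iSup₂_of_le rs hrs le_rfl

lemma depth_le_supportDim [IsNoetherianRing A] [Module.Finite A N] [Nontrivial N] :
    (depth A N : WithBot ℕ∞) ≤ Module.supportDim A N := by
  obtain ⟨d, hd⟩ := WithBot.ne_bot_iff_exists.mp (Module.supportDim_ne_bot_of_nontrivial A N)
  rw [← hd, WithBot.coe_le_coe]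
  refine iSup₂_le fun rs hrs ↦ WithBot.coe_le_coe.mp ?_
  rw [hd, ← Module.supportDim_add_length_eq_supportDim_of_isRegular rs hrs.2]
  have := hrs.2.quot_ofList_smul_nontrivial ⊤
  obtain ⟨e, he⟩ := WithBot.ne_bot_iff_exists.mp (Module.supportDim_ne_bot_of_nontrivial A
    (N ⧸ (Ideal.ofList rs • ⊤ : Submodule A N)))
  rw [← he]
  change (((rs.length : ℕ∞) : WithBot ℕ∞)) ≤ ((e + (rs.length : ℕ∞) : ℕ∞) : WithBot ℕ∞)
  exact WithBot.coe_le_coe.mpr le_add_self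

lemma depth_eq_zero_of_mem_associatedPrimes [IsNoetherianRing A]
    (h : maximalIdeal A ∈ associatedPrimes A N) : depth A N = 0 := by
  rw [← nonpos_iff_eq_zero]
  refine iSup₂_le fun rs hrs ↦ ?_
  obtain _ | ⟨x, rs⟩ := rs
  · simp
  · have hx : x ∈ ({r : A | IsSMulRegular N r}ᶜ : Set A) := by
      rw [← biUnion_associatedPrimes_eq_compl_regular A]
      exact Set.mem_biUnion h (hrs.1 x (by simp))
    exact absurd ((isRegular_cons_iff N x rs).mp hrs.2).1 hx

end LocalDepth

/-! ### Depth over a local ring by `Ext` -/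

section LocalDepthExt

open Abelian Pointwise IsLocalRing RingTheory.Sequence

variable {A : Type u} [CommRing A] [IsLocalRing A] [IsNoetherianRing A] {N : Type u}
  [AddCommGroup N] [Module A N] [Module.Finite A N] [Nontrivial N]

/-- Rees' theorem, tested on the residue field, whose support is the closed point. -/
lemma natCast_le_depth_iff_ext (n : ℕ) :
    (n : ℕ∞) ≤ depth A N ↔ ∀ i < n, Subsingleton
      (Ext (ModuleCat.of A (A ⧸ maximalIdeal A)) (ModuleCat.of A N) i) := by
  have hlt : maximalIdeal A • (⊤ : Submodule A N) < ⊤ := lt_top_iff_ne_top.mpr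
    (Submodule.top_ne_ideal_smul_of_le_jacobson_annihilator (maximalIdeal_le_jacobson _)).symm
  have hsupp : Module.support A (A ⧸ maximalIdeal A) =
      PrimeSpectrum.zeroLocus (maximalIdeal A) := by
    rw [Module.support_eq_zeroLocus, Ideal.annihilator_quotient]
  have hRees := ModuleCat.exists_isRegular_tfae (maximalIdeal A) n (ModuleCat.of A N) hlt
  have h₁ := hRees.out 3 0
  have h₂ := hRees.out 2 3
  rw [natCast_le_depth_iff]
  constructor
  · intro h
    exact h₁.mp h (ModuleCat.of A (A ⧸ maximalIdeal A)) inferInstance inferInstance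
      hsupp.subset
  · intro h
    exact h₂.mp ⟨ModuleCat.of A (A ⧸ maximalIdeal A), inferInstance, inferInstance,
      hsupp, h⟩

/-- The case of `prop_ext_quotSMulTop_iff` in which the Serre class consists of the zero modules. -/
lemma natCast_succ_le_depth_iff {x : A} (hx : x ∈ maximalIdeal A) (hreg : IsSMulRegular N x)
    (n : ℕ) : ((n + 1 : ℕ) : ℕ∞) ≤ depth A N ↔ (n : ℕ∞) ≤ depth A (QuotSMulTop x N) := by
  have := nontrivial_quotSMulTop_of_mem_maximalIdeal N hx
  rw [natCast_le_depth_iff_ext, natCast_le_depth_iff_ext]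
  have h := prop_ext_quotSMulTop_iff (M := N)
    (Limits.IsZero : ObjectProperty (ModuleCat.{u} A)) hx (by
      rw [ModuleCat.isZero_of_iff_subsingleton, Submodule.subsingleton_iff_eq_bot]
      exact (isSMulRegular_iff_ker_lsmul_eq_bot N x).mp hreg) n
  simpa only [ModuleCat.isZero_of_iff_subsingleton] using h

end LocalDepthExt

/-! ### Depth, support and height at a localization -/

section DepthAt

open Pointwise IsLocalRing

variable {R : Type u} [CommRing R] {M M' : Type u} [AddCommGroup M] [Module R M]
  [AddCommGroup M'] [Module R M']

variable (M) in
/-- The depth of the localization `M_𝔭` over the local ring `R_𝔭`. -/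
noncomputable def depthAt (p : PrimeSpectrum R) : ℕ∞ :=
  depth (Localization.AtPrime p.asIdeal) (LocalizedModule p.asIdeal.primeCompl M)

lemma depthAt_congr (e : M ≃ₗ[R] M') (p : PrimeSpectrum R) : depthAt M p = depthAt M' p :=
  depth_congr (IsLocalizedModule.mapEquiv p.asIdeal.primeCompl
    (LocalizedModule.mkLinearMap p.asIdeal.primeCompl M)
    (LocalizedModule.mkLinearMap p.asIdeal.primeCompl M') (Localization p.asIdeal.primeCompl) e)

/-- Localization commutes with the quotient by `xM`. -/
noncomputable def quotSMulTopLocalizedEquiv (p : PrimeSpectrum R) (x : R) :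
    QuotSMulTop (algebraMap R (Localization.AtPrime p.asIdeal) x)
      (LocalizedModule p.asIdeal.primeCompl M) ≃ₗ[Localization.AtPrime p.asIdeal]
        LocalizedModule p.asIdeal.primeCompl (QuotSMulTop x M) :=
  (Submodule.quotEquivOfEq _ _ (by
    rw [← Submodule.ideal_span_singleton_smul, ← Submodule.ideal_span_singleton_smul,
      Submodule.localized, Submodule.localized'_smul, Submodule.localized'_top,
      Submodule.localized'_span, Set.image_singleton, Algebra.linearMap_apply])).trans
    (localizedQuotientEquiv p.asIdeal.primeCompl (x • (⊤ : Submodule R M)))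

variable [IsNoetherianRing R]

lemma depthAt_eq_zero {p : PrimeSpectrum R} (hp : p.asIdeal ∈ associatedPrimes R M) :
    depthAt M p = 0 :=
  depth_eq_zero_of_mem_associatedPrimes
    (Module.associatedPrimes.mem_associatedPrimes_atPrime_of_mem_associatedPrimes hp)

lemma comap_mem_associatedPrimes_iff (p : PrimeSpectrum R)
    (q : Ideal (Localization.AtPrime p.asIdeal)) :
    q.comap (algebraMap R (Localization.AtPrime p.asIdeal)) ∈ associatedPrimes R M ↔
      q ∈ associatedPrimes (Localization.AtPrime p.asIdeal)
        (LocalizedModule p.asIdeal.primeCompl M) := by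
  rw [← Module.associatedPrimes.preimage_comap_associatedPrimes_eq_associatedPrimes_of_isLocalizedModule
    p.asIdeal.primeCompl (Localization.AtPrime p.asIdeal)
    (LocalizedModule.mkLinearMap p.asIdeal.primeCompl M), Set.mem_preimage]

omit [IsNoetherianRing R] in
lemma comap_le (p : PrimeSpectrum R) (q : Ideal (Localization.AtPrime p.asIdeal)) (hq : q ≠ ⊤) :
    q.comap (algebraMap R (Localization.AtPrime p.asIdeal)) ≤ p.asIdeal := by
  exact (Ideal.comap_mono (le_maximalIdeal hq)).trans_eq Localization.AtPrime.under_maximalIdeal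

/-- The zero divisors on `M_𝔭` form the union of its associated primes, and these contract to
associated primes of `M` inside `𝔭`. So `x` may be a zero divisor on `M` itself. -/
lemma isSMulRegular_localizedModule {p : PrimeSpectrum R} {x : R}
    (hx : ∀ q ∈ associatedPrimes R M, q ≤ p.asIdeal → x ∉ q) :
    IsSMulRegular (LocalizedModule p.asIdeal.primeCompl M)
      (algebraMap R (Localization.AtPrime p.asIdeal) x) := by
  by_contra h
  have h' : algebraMap R (Localization.AtPrime p.asIdeal) x ∈
      ({r | IsSMulRegular (LocalizedModule p.asIdeal.primeCompl M) r}ᶜ : Set _) := h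
  rw [← biUnion_associatedPrimes_eq_compl_regular] at h'
  obtain ⟨q, hq, hxq⟩ := Set.mem_iUnion₂.mp h'
  exact hx _ ((comap_mem_associatedPrimes_iff p q).mpr hq) (comap_le p q hq.isPrime.ne_top) hxq

lemma natCast_succ_le_depthAt_iff [Module.Finite R M] {p : PrimeSpectrum R}
    (hp : p ∈ Module.support R M) {x : R} (hxp : x ∈ p.asIdeal)
    (hx : ∀ q ∈ associatedPrimes R M, q ≤ p.asIdeal → x ∉ q) (n : ℕ) :
    ((n + 1 : ℕ) : ℕ∞) ≤ depthAt M p ↔ (n : ℕ∞) ≤ depthAt (QuotSMulTop x M) p := by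
  have : Nontrivial (LocalizedModule p.asIdeal.primeCompl M) := hp
  rw [depthAt, natCast_succ_le_depth_iff
    ((IsLocalization.AtPrime.to_map_mem_maximal_iff _ p.asIdeal x).mpr hxp)
      (isSMulRegular_localizedModule hx), depthAt, depth_congr (quotSMulTopLocalizedEquiv p x)]

lemma mem_support_of_mem_associatedPrimes {N : Type*} [AddCommGroup N] [Module R N]
    {q p : PrimeSpectrum R}
    (hq : q.asIdeal ∈ associatedPrimes R N) (hqp : q ≤ p) : p ∈ Module.support R N := by
  obtain ⟨-, m, hm⟩ := isAssociatedPrime_iff.mp hq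
  refine Module.mem_support_mono hqp (Module.mem_support_iff_exists_annihilator.mpr ⟨m, ?_⟩)
  intro r hr
  rw [hm, Submodule.mem_colon_singleton, Submodule.mem_bot]
  exact (Submodule.mem_annihilator_span_singleton m r).mp hr

/-- Both supports are the upward closures of the associated primes, which correspond under
contraction. -/
lemma mem_support_localizedModule_iff [Module.Finite R M] (p : PrimeSpectrum R)
    (q : PrimeSpectrum (Localization.AtPrime p.asIdeal)) :
    q ∈ Module.support (Localization.AtPrime p.asIdeal)
        (LocalizedModule p.asIdeal.primeCompl M) ↔
      (IsLocalization.AtPrime.primeSpectrumOrderIso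
        (Localization.AtPrime p.asIdeal) p.asIdeal q).1 ∈
        Module.support R M := by
  set e := IsLocalization.AtPrime.primeSpectrumOrderIso (Localization.AtPrime p.asIdeal) p.asIdeal
  constructor
  · intro hq
    obtain ⟨Q, hQ, hQq⟩ := exists_mem_associatedPrimes_le hq
    have hle : e ⟨Q, hQ.isPrime⟩ ≤ e q := e.monotone hQq
    exact mem_support_of_mem_associatedPrimes (q := (e ⟨Q, hQ.isPrime⟩).1)
      ((comap_mem_associatedPrimes_iff p Q).mpr hQ) hle
  · intro hq
    obtain ⟨P, hP, hPq⟩ := exists_mem_associatedPrimes_le hq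
    obtain ⟨Q, hQ⟩ := e.surjective ⟨⟨P, hP.isPrime⟩, le_trans (b := (e q).1) hPq (e q).2⟩
    refine mem_support_of_mem_associatedPrimes (q := Q)
      ((comap_mem_associatedPrimes_iff p Q.asIdeal).mp ?_) (e.le_iff_le.mp (hQ ▸ hPq))
    have : (e Q).1.asIdeal = P := by rw [hQ]
    rw [← this] at hP
    exact hP

lemma supportDim_localizedModule_eq_height [Module.Finite R M] {p : PrimeSpectrum R}
    (hp : p ∈ Module.support R M) :
    Module.supportDim (Localization.AtPrime p.asIdeal) (LocalizedModule p.asIdeal.primeCompl M) =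
      Order.height (⟨p, hp⟩ : Module.support R M) := by
  let e := IsLocalization.AtPrime.primeSpectrumOrderIso (Localization.AtPrime p.asIdeal) p.asIdeal
  rw [Order.height_eq_krullDim_Iic, Module.supportDim]
  refine Order.krullDim_eq_of_orderIso
    { toFun q := ⟨⟨(e q.1).1, (mem_support_localizedModule_iff p q.1).mp q.2⟩, (e q.1).2⟩
      invFun q := ⟨e.symm ⟨q.1.1, q.2⟩, (mem_support_localizedModule_iff p _).mpr (by
        change (e (e.symm _)).1 ∈ _
        rw [e.apply_symm_apply]
        exact q.1.2)⟩
      left_inv q := Subtype.ext (e.symm_apply_apply _)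
      right_inv q := Subtype.ext (Subtype.ext (by
        change (e (e.symm _)).1 = _
        rw [e.apply_symm_apply]))
      map_rel_iff' := e.le_iff_le }

lemma depthAt_le_height [Module.Finite R M] {p : PrimeSpectrum R}
    (hp : p ∈ Module.support R M) :
    depthAt M p ≤ Order.height (⟨p, hp⟩ : Module.support R M) := by
  have : Nontrivial (LocalizedModule p.asIdeal.primeCompl M) := hp
  rw [← WithBot.coe_le_coe, ← supportDim_localizedModule_eq_height hp]
  exact depth_le_supportDim

lemma isCohenMacaulay_iff [Module.Finite R M] {p : PrimeSpectrum R}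
    (hp : p ∈ Module.support R M) :
    IsCohenMacaulay (Localization.AtPrime p.asIdeal) (LocalizedModule p.asIdeal.primeCompl M) ↔
      depthAt M p = Order.height (⟨p, hp⟩ : Module.support R M) := by
  have : Nontrivial (LocalizedModule p.asIdeal.primeCompl M) := hp
  rw [IsCohenMacaulay, supportDim_localizedModule_eq_height hp, WithBot.coe_inj,
    or_iff_right (not_subsingleton _), depthAt]

omit [IsNoetherianRing R] in
lemma ht_eq_height {p : PrimeSpectrum R} (hp : p ∈ Module.support R M) :
    ht R M p.asIdeal = Order.height (⟨p, hp⟩ : Module.support R M) := by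
  refine le_antisymm (iInf₂_le (⟨p, hp⟩ : Module.support R M) le_rfl) (le_iInf₂ fun q hq ↦ ?_)
  exact Order.height_mono hq

end DepthAt

/-! ### The grade as an infimum of local depths -/

section GradeFormula

open Pointwise

variable {R : Type u} [CommRing R] [IsNoetherianRing R]
  (S : ObjectProperty (ModuleCat.{u} R)) [S.IsSerreClass]
  {M : Type u} [AddCommGroup M] [Module R M] [Module.Finite R M]

omit [IsNoetherianRing R] in
lemma mem_support_quotSMulTop_iff {x : R} {q : PrimeSpectrum R} :
    q ∈ Module.support R (QuotSMulTop x M) ↔ q ∈ Module.support R M ∧ x ∈ q.asIdeal := by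
  rw [Module.support_quotSMulTop, Set.mem_inter_iff, PrimeSpectrum.mem_zeroLocus,
    Set.singleton_subset_iff, SetLike.mem_coe]

omit [IsNoetherianRing R] in
lemma mem_support_quotient_iff {a : Ideal R} {q : PrimeSpectrum R} :
    q ∈ Module.support R (M ⧸ (a • ⊤ : Submodule R M)) ↔
      q ∈ Module.support R M ∧ a ≤ q.asIdeal := by
  rw [Module.support_quotient, Set.mem_inter_iff, PrimeSpectrum.mem_zeroLocus,
    SetLike.coe_subset_coe]

/-- The `S`-grade of `𝔞` on `M` is the infimum of `depth M_𝔮` over `𝔮 ∈ S-Supp M ∩ V(𝔞)`. -/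
theorem natCast_le_sEGrade_iff (a : Ideal R) (n : ℕ) :
    (n : ℕ∞) ≤ sEGrade S a M ↔ ∀ q ∈ sSupp S M, a ≤ q.asIdeal → (n : ℕ∞) ≤ depthAt M q := by
  induction n generalizing M with
  | zero => simp
  | succ n ih =>
    -- For such an `x` both sides reduce to `M/xM`. An associated prime below `𝔮 ∈ S-Supp M` lies in
    -- `S-Ass M`, so it misses `x`.
    have key {x : R} (hxa : x ∈ a) (hx : ∀ p ∈ sAss S M, x ∉ p.asIdeal) :
        ((n + 1 : ℕ) : ℕ∞) ≤ sEGrade S a M ↔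
          ∀ q ∈ sSupp S M, a ≤ q.asIdeal → ((n + 1 : ℕ) : ℕ∞) ≤ depthAt M q := by
      rw [le_sEGrade_iff, prop_ext_quotSMulTop_iff S hxa (prop_ker_lsmul S hx),
        ← le_sEGrade_iff, ih]
      have hsupp (q : PrimeSpectrum R) (haq : a ≤ q.asIdeal) :
          q ∈ sSupp S (QuotSMulTop x M) ↔ q ∈ sSupp S M := by
        rw [sSupp, sSupp, Set.mem_ofPred_eq, Set.mem_ofPred_eq, mem_support_quotSMulTop_iff,
          and_iff_left (haq hxa)]
      refine forall_congr' fun q ↦ ⟨fun h hq haq ↦ ?_, fun h hq haq ↦ ?_⟩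
      · rw [natCast_succ_le_depthAt_iff hq.1 (haq hxa) fun P hP hPq ↦ hx ⟨P, hP.isPrime⟩
          ⟨hP, fun hPS ↦ hq.2 (prop_quotient_of_le S hPq hPS)⟩]
        exact h ((hsupp q haq).mpr hq) haq
      · have hq' := (hsupp q haq).mp hq
        rw [← natCast_succ_le_depthAt_iff hq'.1 (haq hxa) fun P hP hPq ↦ hx ⟨P, hP.isPrime⟩
          ⟨hP, fun hPS ↦ hq'.2 (prop_quotient_of_le S hPq hPS)⟩]
        exact h hq' haq
    constructor
    · intro h
      obtain ⟨x, hxa, hx⟩ := exists_mem_notMem_sAss S fun p hp ↦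
        not_le_of_mem_sAss S ((le_sEGrade_iff S a M _).mp h 0 n.succ_pos) hp
      exact (key hxa hx).mp h
    · intro h
      -- A prime of `S-Ass M` containing `𝔞` would have local depth zero, against the bound `n + 1`.
      obtain ⟨x, hxa, hx⟩ := exists_mem_notMem_sAss (M := M) (a := a) S fun p hp hap ↦ by
        have := h p ⟨mem_support_of_mem_associatedPrimes hp.1 le_rfl, hp.2⟩ hap
        rw [depthAt_eq_zero hp.1] at this
        simp at this
      exact (key hxa hx).mpr h

omit [S.IsSerreClass] [IsNoetherianRing R] [Module.Finite R M] in
lemma sHt_eq_ht {p : PrimeSpectrum R} (hp : p ∈ sSupp S M) :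
    sHt S M p.asIdeal = ht R M p.asIdeal := by
  refine le_antisymm (iInf₂_le p ⟨hp, subset_rfl (a := (p.asIdeal : Set R))⟩)
    (le_iInf₂ fun q hq ↦ ?_)
  rw [ht_eq_height hp.1, ht_eq_height hq.1.1]
  exact Order.height_mono (show p ≤ q from hq.2)

end GradeFormula

/-! ### Prime avoidance for cosets -/

section CosetAvoidance

variable {R : Type*} [CommRing R]

/-- Prime avoidance for the coset `x + J`. -/
lemma exists_mem_add_notMem (s : Finset (Ideal R)) (hs : ∀ P ∈ s, P.IsPrime) (x : R) (J : Ideal R)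
    (h : ∀ P ∈ s, ¬ Ideal.span {x} ⊔ J ≤ P) : ∃ b ∈ J, ∀ P ∈ s, x + b ∉ P := by
  classical
  induction hn : s.card generalizing s with
  | zero =>
    obtain rfl := Finset.card_eq_zero.mp hn
    exact ⟨0, J.zero_mem, by simp⟩
  | succ n ih =>
    obtain ⟨P, hP⟩ := s.exists_minimal (Finset.card_pos.mp (by omega))
    have hPs := hP.prop
    have hPp := hs P hPs
    obtain ⟨b, hbJ, hb⟩ := ih (s.erase P) (fun Q hQ ↦ hs Q (Finset.mem_of_mem_erase hQ))
      (fun Q hQ ↦ h Q (Finset.mem_of_mem_erase hQ)) (by rw [Finset.card_erase_of_mem hPs]; omega)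
    by_cases hbP : x + b ∈ P
    swap
    · refine ⟨b, hbJ, fun Q hQ ↦ ?_⟩
      obtain rfl | hQP := eq_or_ne Q P
      · exact hbP
      · exact hb Q (Finset.mem_erase.mpr ⟨hQP, hQ⟩)
    have hJP : ¬ J ≤ P := fun hJP ↦ h P hPs <| sup_le
      ((Ideal.span_singleton_le_iff_mem _).mpr ((P.add_mem_iff_left (hJP hbJ)).mp hbP)) hJP
    -- As `P` is minimal in `s`, it contains no other member. Hence some `z ∈ J` lies in all the
    -- others but not in `P`, and adding it corrects `b` at `P` without disturbing the rest.
    have hprod : ¬ J * ∏ Q ∈ s.erase P, Q ≤ P := by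
      rw [hPp.mul_le, hPp.prod_le, not_or]
      refine ⟨hJP, ?_⟩
      rintro ⟨Q, hQ, hQP⟩
      rw [Finset.mem_erase] at hQ
      exact hQ.1 (le_antisymm hQP (hP.le_of_le hQ.2 hQP))
    obtain ⟨z, hz, hzP⟩ := SetLike.not_le_iff_exists.mp hprod
    refine ⟨b + z, J.add_mem hbJ (Ideal.mul_le_left hz), fun Q hQ ↦ ?_⟩
    rw [← add_assoc]
    obtain rfl | hQP := eq_or_ne Q P
    · rwa [Q.add_mem_iff_right hbP]
    · have hQ' := Finset.mem_erase.mpr ⟨hQP, hQ⟩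
      have hzQ : z ∈ Q := Ideal.le_of_dvd (Finset.dvd_prod_of_mem (fun Q ↦ Q) hQ')
        (Ideal.mul_le_right hz)
      rw [Q.add_mem_iff_left hzQ]
      exact hb Q hQ'

end CosetAvoidance

/-! ### Associated primes of quotients and Krull's height theorem -/

section Unmixed

open Pointwise RingTheory.Sequence

variable {R : Type u} [CommRing R] [IsNoetherianRing R]

/-- The depth bound keeps the ideal out of every associated prime of `M` below `𝔭`, where the depth
is zero. Coset avoidance then replaces `x` by some `x + b` generating the same ideal with `rs` and
regular at `𝔭`. After all elements are divided out, `𝔭` is associated and the depth is zero. -/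
lemma depthAt_le_length {M : Type u} [AddCommGroup M] [Module R M] [Module.Finite R M]
    (rs : List R) (p : PrimeSpectrum R)
    (h : ∀ q ∈ Module.support R M, Ideal.ofList rs ≤ q.asIdeal → q ≤ p →
      (rs.length : ℕ∞) ≤ depthAt M q)
    (hp : p.asIdeal ∈ associatedPrimes R (M ⧸ (Ideal.ofList rs • ⊤ : Submodule R M))) :
    depthAt M p ≤ rs.length := by
  induction rs generalizing M with
  | nil =>
    rw [depthAt_eq_zero]
    · simp
    · rw [Ideal.ofList_nil, Submodule.bot_smul] at hp
      rwa [← LinearEquiv.AssociatedPrimes.eq (Submodule.quotEquivOfEqBot (⊥ : Submodule R M) rfl)]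
  | cons x rs ih =>
    have hfin : {P ∈ associatedPrimes R M | P ≤ p.asIdeal}.Finite :=
      (associatedPrimes.finite R M).subset (Set.sep_subset _ _)
    obtain ⟨b, hb, hxb⟩ := exists_mem_add_notMem hfin.toFinset
      (fun P hP ↦ (hfin.mem_toFinset.mp hP).1.isPrime) x (Ideal.ofList rs) fun P hP hle ↦ by
        obtain ⟨hPM, hPp⟩ := hfin.mem_toFinset.mp hP
        have := h ⟨P, hPM.isPrime⟩ (mem_support_of_mem_associatedPrimes hPM le_rfl)
          (by rwa [Ideal.ofList_cons]) hPp
        rw [depthAt_eq_zero hPM] at this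
        simp at this
    replace hxb : ∀ P ∈ associatedPrimes R M, P ≤ p.asIdeal → x + b ∉ P :=
      fun P hP hPp ↦ hxb P (hfin.mem_toFinset.mpr ⟨hP, hPp⟩)
    have hlist : Ideal.ofList ((x + b) :: rs) = Ideal.ofList (x :: rs) := by
      rw [Ideal.ofList_cons, Ideal.ofList_cons]
      refine le_antisymm (sup_le ?_ le_sup_right) (sup_le ?_ le_sup_right) <;>
        rw [Ideal.span_singleton_le_iff_mem]
      · exact Ideal.add_mem _ (Ideal.mem_sup_left (Ideal.mem_span_singleton_self x))
          (Ideal.mem_sup_right hb)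
      · refine (Ideal.add_mem_iff_left _ (b := b) ?_).mp ?_
        · exact Ideal.mem_sup_right hb
        · exact Ideal.mem_sup_left (Ideal.mem_span_singleton_self _)
    rw [← hlist] at h hp
    obtain ⟨hpM, hpl⟩ := mem_support_quotient_iff.mp
      (mem_support_of_mem_associatedPrimes hp le_rfl)
    have hmem {q : PrimeSpectrum R} (hq : Ideal.ofList ((x + b) :: rs) ≤ q.asIdeal) :
        x + b ∈ q.asIdeal := hq (Ideal.subset_span (by simp))
    have hquot : depthAt (QuotSMulTop (x + b) M) p ≤ rs.length := by
      refine ih (fun q hq hrs hqp ↦ ?_) ?_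
      · rw [mem_support_quotSMulTop_iff] at hq
        have hle : Ideal.ofList ((x + b) :: rs) ≤ q.asIdeal := by
          rw [Ideal.ofList_cons]
          exact sup_le ((Ideal.span_singleton_le_iff_mem _).mpr hq.2) hrs
        rw [← natCast_succ_le_depthAt_iff hq.1 hq.2 fun P hP hPq ↦ hxb P hP (hPq.trans hqp)]
        exact h q hq.1 hle hqp
      · rwa [← LinearEquiv.AssociatedPrimes.eq
          (Submodule.quotOfListConsSMulTopEquivQuotSMulTopInner M (x + b) rs)]
    by_contra! hlt
    have := (natCast_succ_le_depthAt_iff hpM (hmem hpl) hxb (rs.length + 1)).mp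
      (by rw [Nat.cast_succ]; exact Order.add_one_le_of_lt hlt)
    exact absurd (this.trans hquot) (by norm_cast; omega)

variable {N : Type u} [AddCommGroup N] [Module R N] [Module.Finite R N]

omit [IsNoetherianRing R] in
lemma minimal_support_iff {P : PrimeSpectrum R} :
    Minimal (· ∈ Module.support R N) P ↔ P.asIdeal ∈ (Module.annihilator R N).minimalPrimes := by
  simp only [Minimal, Module.mem_support_iff_of_finite]
  refine ⟨fun h ↦ ⟨⟨P.isPrime, h.1⟩, fun Q hQ hQP ↦ h.2 (y := ⟨Q, hQ.1⟩) hQ.2 hQP⟩,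
    fun h ↦ ⟨h.1.2, fun Q hQ hQP ↦ h.2 ⟨Q.isPrime, hQ⟩ hQP⟩⟩

lemma Minimal.mem_associatedPrimes {P : PrimeSpectrum R}
    (h : Minimal (· ∈ Module.support R N) P) : P.asIdeal ∈ associatedPrimes R N :=
  Module.associatedPrimes.minimalPrimes_annihilator_subset_associatedPrimes R N
    (minimal_support_iff.mp h)

omit [IsNoetherianRing R] in
lemma exists_minimal_support_le {q : PrimeSpectrum R} (hq : q ∈ Module.support R N) :
    ∃ P ≤ q, Minimal (· ∈ Module.support R N) P := by
  obtain ⟨P, hP, hPq⟩ := Ideal.exists_minimalPrimes_le (Module.mem_support_iff_of_finite.mp hq)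
  exact ⟨⟨P, hP.isPrime⟩, hPq, minimal_support_iff.mpr hP⟩

omit [IsNoetherianRing R] in
variable (R N) in
lemma exists_orderIso_support : ∃ e : PrimeSpectrum (R ⧸ Module.annihilator R N) ≃o
    Module.support R N,
    ∀ Q, (e Q).1.asIdeal = Q.asIdeal.comap (Ideal.Quotient.mk (Module.annihilator R N)) :=
  ⟨(Module.annihilator R N).primeSpectrumQuotientOrderIsoZeroLocus.trans
    (OrderIso.setCongr _ _ Module.support_eq_zeroLocus.symm), fun _ ↦ rfl⟩

/-- Krull's height theorem for finite modules. -/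
lemma height_le_length_of_minimal (rs : List R) {P : PrimeSpectrum R}
    (hP : Minimal (· ∈ Module.support R (N ⧸ (Ideal.ofList rs • ⊤ : Submodule R N))) P)
    (hPN : P ∈ Module.support R N) :
    Order.height (⟨P, hPN⟩ : Module.support R N) ≤ rs.length := by
  classical
  -- Over `R/Ann N` the support becomes the whole spectrum, where Krull's theorem for ideals
  -- applies.
  obtain ⟨e, he⟩ := exists_orderIso_support R N
  have hlist (Q : PrimeSpectrum (R ⧸ Module.annihilator R N)) :
      Ideal.ofList (rs.map (Ideal.Quotient.mk (Module.annihilator R N))) ≤ Q.asIdeal ↔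
        Ideal.ofList rs ≤ (e Q).1.asIdeal := by
    rw [← Ideal.map_ofList, Ideal.map_le_iff_le_comap, he]
  obtain ⟨Q, hQ⟩ := e.surjective ⟨P, hPN⟩
  have hQP : (e Q).1 = P := congrArg Subtype.val hQ
  have hrs : Ideal.ofList rs ≤ P.asIdeal := (mem_support_quotient_iff.mp hP.prop).2
  have hmin : Q.asIdeal ∈
      (Ideal.ofList (rs.map (Ideal.Quotient.mk (Module.annihilator R N)))).minimalPrimes := by
    refine ⟨⟨Q.isPrime, (hlist Q).mpr (hQP ▸ hrs)⟩, fun J hJ hJQ ↦ ?_⟩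
    obtain ⟨J', rfl⟩ : ∃ J' : PrimeSpectrum (R ⧸ Module.annihilator R N), J'.asIdeal = J :=
      ⟨⟨J, hJ.1⟩, rfl⟩
    have h₁ : (e J').1 ∈ Module.support R (N ⧸ (Ideal.ofList rs • ⊤ : Submodule R N)) :=
      mem_support_quotient_iff.mpr ⟨(e J').2, (hlist J').mp hJ.2⟩
    have h₂ : e J' ≤ e Q := e.monotone hJQ
    have h₃ : P ≤ (e J').1 := hP.le_of_le h₁ (hQP ▸ h₂)
    have h₄ : e Q ≤ e J' := by rwa [hQ]
    exact e.le_iff_le.mp h₄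
  rw [← hQ]
  calc Order.height (e Q) = Order.height Q := Order.height_orderIso e Q
    _ = Q.asIdeal.height := (PrimeSpectrum.height_eq_orderHeight Q).symm
    _ ≤ ((rs.map (Ideal.Quotient.mk (Module.annihilator R N))).toFinset.card : ℕ∞) := by
      refine Ideal.height_le_card_of_mem_minimalPrimes_span_finset ?_
      rwa [List.coe_toFinset]
    _ ≤ rs.length := by
      exact_mod_cast (List.toFinset_card_le _).trans_eq (List.length_map _)

end Unmixed

/-! ### Unmixedness and the Cohen–Macaulay property -/

section Construction

open Pointwise RingTheory.Sequence

variable {R : Type u} [CommRing R] [IsNoetherianRing R]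
  (S : ObjectProperty (ModuleCat.{u} R)) [S.IsSerreClass]
  {M : Type u} [AddCommGroup M] [Module R M] [Module.Finite R M]

/-- Every prime of `Supp (M/𝔞M)` has height at least the number of generators, and by
`depthAt_le_length` a prime of `S-Ass (M/𝔞M)` has at most that height. A smaller prime of the
support would have strictly smaller height. -/
lemma isUnmixedOn_of_depthAt_eq_height
    (hCM : ∀ q (hq : q ∈ sSupp S M),
      depthAt M q = Order.height (⟨q, hq.1⟩ : Module.support R M))
    (rs : List R) (hrs : (rs.length : ℕ∞) = ht R M (Ideal.ofList rs)) :
    IsUnmixedOn S (Ideal.ofList rs) M := by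
  have hht {q : PrimeSpectrum R} (hq : q ∈ Module.support R M)
      (hle : Ideal.ofList rs ≤ q.asIdeal) :
      (rs.length : ℕ∞) ≤ Order.height (⟨q, hq⟩ : Module.support R M) := by
    rw [hrs]
    exact iInf₂_le (⟨q, hq⟩ : Module.support R M) hle
  ext p
  refine and_congr_left fun hpS ↦ ⟨fun hp ↦ ?_, Minimal.mem_associatedPrimes⟩
  have hp' := mem_support_of_mem_associatedPrimes hp le_rfl
  obtain ⟨hpM, hle⟩ := mem_support_quotient_iff.mp hp'
  have hS {q : PrimeSpectrum R} (hqp : q ≤ p) : ¬ S (ModuleCat.of R (R ⧸ q.asIdeal)) :=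
    fun h ↦ hpS (prop_quotient_of_le S hqp h)
  have hpn : Order.height (⟨p, hpM⟩ : Module.support R M) ≤ rs.length := by
    rw [← hCM p ⟨hpM, hpS⟩]
    refine depthAt_le_length rs p (fun q hq hrsq hqp ↦ ?_) hp
    rw [hCM q ⟨hq, hS hqp⟩]
    exact hht hq hrsq
  refine ⟨hp', fun q hq hqp ↦ ?_⟩
  obtain ⟨hqM, hrsq⟩ := mem_support_quotient_iff.mp hq
  by_contra hpq
  have hlt : (⟨q, hqM⟩ : Module.support R M) < ⟨p, hpM⟩ := lt_of_le_not_ge hqp hpq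
  have hfin : Order.height (⟨q, hqM⟩ : Module.support R M) < ⊤ :=
    ((Order.height_mono hlt.le).trans hpn).trans_lt (ENat.natCast_lt_top _)
  exact absurd ((Order.height_strictMono hlt hfin).trans_le hpn) (hht hqM hrsq).not_gt

variable {S}

/-- The height clause, with Krull's theorem, shows that the ideal has height exactly `i`, so
unmixedness applies at the next stage. The depth clause records that `i` elements have been divided
out regularly at `𝔭`. -/
lemma exists_list_of_isUnmixedOn
    (h : ∀ rs : List R, (rs.length : ℕ∞) = ht R M (Ideal.ofList rs) →
      IsUnmixedOn S (Ideal.ofList rs) M)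
    {p : PrimeSpectrum R} (hp : p ∈ sSupp S M) (i : ℕ)
    (hi : (i : ℕ∞) ≤ Order.height (⟨p, hp.1⟩ : Module.support R M)) :
    ∃ rs : List R, rs.length = i ∧ Ideal.ofList rs ≤ p.asIdeal ∧
      (∀ q (hq : q ∈ Module.support R M), Ideal.ofList rs ≤ q.asIdeal →
        (i : ℕ∞) ≤ Order.height (⟨q, hq⟩ : Module.support R M)) ∧
      ∀ k : ℕ, (k : ℕ∞) ≤ depthAt (M ⧸ (Ideal.ofList rs • ⊤ : Submodule R M)) p →
        ((k + i : ℕ) : ℕ∞) ≤ depthAt M p := by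
  induction i with
  | zero =>
    refine ⟨[], rfl, by simp, by simp, fun k hk ↦ hk.trans_eq (depthAt_congr ?_ p)⟩
    exact Submodule.quotEquivOfEqBot _ (by rw [Ideal.ofList_nil, Submodule.bot_smul])
  | succ i ih =>
    obtain ⟨rs, hlen, hrsp, hht, hdepth⟩ :=
      ih ((Nat.cast_le.mpr i.le_succ).trans hi)
    set N := M ⧸ (Ideal.ofList rs • ⊤ : Submodule R M)
    have hkrull {P : PrimeSpectrum R} (hP : Minimal (· ∈ Module.support R N) P)
        (hPM : P ∈ Module.support R M) :
        Order.height (⟨P, hPM⟩ : Module.support R M) ≤ i :=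
      hlen ▸ height_le_length_of_minimal rs hP hPM
    have hsuppN {q : PrimeSpectrum R} : q ∈ Module.support R N ↔
        q ∈ Module.support R M ∧ Ideal.ofList rs ≤ q.asIdeal := mem_support_quotient_iff
    have hpN : p ∈ Module.support R N := hsuppN.mpr ⟨hp.1, hrsp⟩
    have hrs : (rs.length : ℕ∞) = ht R M (Ideal.ofList rs) := by
      refine le_antisymm (le_iInf₂ fun q hq ↦ hlen ▸ hht q.1 q.2 hq) ?_
      obtain ⟨P, -, hP⟩ := exists_minimal_support_le hpN
      obtain ⟨hPM, hle⟩ := hsuppN.mp hP.prop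
      exact (iInf₂_le (⟨P, hPM⟩ : Module.support R M) hle).trans (hlen ▸ hkrull hP hPM)
    have hunm := h rs hrs
    have hfin : {P ∈ associatedPrimes R N |
        ∃ P', P'.asIdeal = P ∧ Minimal (· ∈ Module.support R N) P'}.Finite :=
      (associatedPrimes.finite R N).subset (Set.sep_subset _ _)
    -- Otherwise prime avoidance puts `𝔭` inside a minimal prime of `Supp N`, of height at most `i`,
    -- while `𝔭` has height at least `i + 1`.
    obtain ⟨y, hyp, hy⟩ : ∃ y ∈ p.asIdeal, ∀ P : PrimeSpectrum R,
        Minimal (· ∈ Module.support R N) P → y ∉ P.asIdeal := by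
      by_contra! hcon
      obtain ⟨_, ⟨-, P, rfl, hP⟩, hpP⟩ := (p.asIdeal.subset_union_prime_finite hfin (f := id) 0 0
        fun _ h _ _ ↦ h.1.isPrime).1 fun y hy ↦ by
          obtain ⟨P, hP, hyP⟩ := hcon y hy
          exact Set.mem_biUnion (x := P.asIdeal)
            ⟨Minimal.mem_associatedPrimes hP, P, rfl, hP⟩ hyP
      have hPM := (hsuppN.mp hP.prop).1
      have := hi.trans ((Order.height_mono (a := (⟨p, hp.1⟩ : Module.support R M))
        (b := ⟨P, hPM⟩) hpP).trans (hkrull hP hPM))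
      exact absurd this (by norm_cast; omega)
    refine ⟨y :: rs, by simp [hlen], ?_, fun q hq hle ↦ ?_, fun k hk ↦ ?_⟩
    · rw [Ideal.ofList_cons]
      exact sup_le ((Ideal.span_singleton_le_iff_mem _).mpr hyp) hrsp
    · rw [Ideal.ofList_cons, sup_le_iff, Ideal.span_singleton_le_iff_mem] at hle
      obtain ⟨P, hPq, hP⟩ := exists_minimal_support_le (hsuppN.mpr ⟨hq, hle.2⟩)
      obtain ⟨hPM, hrsP⟩ := hsuppN.mp hP.prop
      have hlt : (⟨P, hPM⟩ : Module.support R M) < ⟨q, hq⟩ :=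
        lt_of_le_of_ne hPq fun heq ↦ hy P hP (by
          rw [show P = q from congrArg Subtype.val heq]
          exact hle.1)
      have := Order.height_strictMono hlt ((hkrull hP hPM).trans_lt (ENat.natCast_lt_top _))
      rw [Nat.cast_succ]
      exact Order.add_one_le_of_lt ((hht P hPM hrsP).trans_lt this)
    · rw [depthAt_congr (Submodule.quotOfListConsSMulTopEquivQuotSMulTopOuter M y rs),
        ← natCast_succ_le_depthAt_iff hpN hyp fun P hP hPp hyP ↦ hy ⟨P, hP.isPrime⟩ ?_ hyP] at hk
      · rw [add_comm i, ← add_assoc]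
        exact hdepth (k + 1) hk
      -- Unmixedness enters here: an associated prime of `N` below `𝔭` is in `S-Ass N`, hence
      -- minimal, and `y` was chosen to avoid it.
      · have hmem : (⟨P, hP.isPrime⟩ : PrimeSpectrum R) ∈ sAss S N :=
          ⟨hP, fun hPS ↦ hp.2 (prop_quotient_of_le S hPp hPS)⟩
        rw [hunm] at hmem
        exact hmem.1

lemma depthAt_eq_height_of_isUnmixedOn
    (h : ∀ rs : List R, (rs.length : ℕ∞) = ht R M (Ideal.ofList rs) →
      IsUnmixedOn S (Ideal.ofList rs) M)
    {p : PrimeSpectrum R} (hp : p ∈ sSupp S M) :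
    depthAt M p = Order.height (⟨p, hp.1⟩ : Module.support R M) := by
  refine le_antisymm (depthAt_le_height hp.1) (ENat.forall_natCast_le_iff_le.mp fun i hi ↦ ?_)
  obtain ⟨rs, -, -, -, hrs⟩ := exists_list_of_isUnmixedOn h hp i hi
  simpa using hrs 0 (by simp)

end Construction

end SerreCM

theorem proposition3p3 {R : Type u} [CommRing R] [IsNoetherianRing R]
    (S : ObjectProperty (ModuleCat.{u} R)) [S.IsSerreClass]
    (M : Type u) [AddCommGroup M] [Module R M] [Module.Finite R M] :
    List.TFAE [
      ∀ a : Ideal R, SerreCM.sEGrade S a M = SerreCM.sHt S M a,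
      ∀ p ∈ SerreCM.sSupp S M,
        SerreCM.sEGrade S p.asIdeal M = SerreCM.sHt S M p.asIdeal ∧
          SerreCM.sHt S M p.asIdeal = SerreCM.ht R M p.asIdeal,
      ∀ p ∈ SerreCM.sSupp S M,
        SerreCM.IsCohenMacaulay (Localization.AtPrime p.asIdeal)
          (LocalizedModule p.asIdeal.primeCompl M),
      ∀ (a : Ideal R) (n : ℕ) (x : Fin n → R), Ideal.span (Set.range x) = a →
        (n : ℕ∞) = SerreCM.ht R M a → SerreCM.IsUnmixedOn S a M] := by
  tfae_have 1 → 2 := fun h p hp ↦ ⟨h p.asIdeal, SerreCM.sHt_eq_ht S hp⟩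
  tfae_have 2 → 3 := fun h p hp ↦ by
    rw [SerreCM.isCohenMacaulay_iff hp.1]
    refine le_antisymm (SerreCM.depthAt_le_height hp.1) ?_
    rw [← SerreCM.ht_eq_height hp.1, ← (h p hp).2, ← (h p hp).1]
    -- Comparing natural lower bounds also covers an infinite grade.
    exact ENat.forall_natCast_le_iff_le.mp fun n hn ↦
      (SerreCM.natCast_le_sEGrade_iff S p.asIdeal n).mp hn p hp le_rfl
  tfae_have 3 → 1 := fun h a ↦ by
    refine ENat.eq_of_forall_natCast_le_iff fun n ↦ ?_
    rw [SerreCM.natCast_le_sEGrade_iff, SerreCM.sHt, le_iInf₂_iff]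
    refine forall_congr' fun q ↦ ⟨fun H hq ↦ ?_, fun H hq haq ↦ ?_⟩
    · rw [SerreCM.ht_eq_height hq.1.1, ← (SerreCM.isCohenMacaulay_iff hq.1.1).mp (h q hq.1)]
      exact H hq.1 hq.2
    · rw [(SerreCM.isCohenMacaulay_iff hq.1).mp (h q hq), ← SerreCM.ht_eq_height hq.1]
      exact H ⟨hq, haq⟩
  have hlist (n : ℕ) (x : Fin n → R) : Ideal.ofList (List.ofFn x) = Ideal.span (Set.range x) :=
    congrArg Ideal.span (Set.ext fun r ↦ by simp [List.mem_ofFn])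
  tfae_have 3 → 4 := fun h a n x hx hn ↦ by
    subst hx
    rw [← hlist] at hn ⊢
    exact SerreCM.isUnmixedOn_of_depthAt_eq_height S
      (fun q hq ↦ (SerreCM.isCohenMacaulay_iff hq.1).mp (h q hq)) _ (by simpa using hn)
  tfae_have 4 → 3 := fun h p hp ↦ by
    rw [SerreCM.isCohenMacaulay_iff hp.1]
    refine SerreCM.depthAt_eq_height_of_isUnmixedOn (fun rs hrs ↦ ?_) hp
    refine h _ rs.length rs.get ?_ hrs
    rw [← hlist, List.ofFn_get]
  tfae_finish
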